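/- Permutations of $[N]$ are bijections $\pi:[N]\to[N]$ from positions to elements, so $\pi^{-1}(i)$ is the position of element $i$. Let $v_\pi=(\pi^{-1}(1),\dots,\pi^{-1}(N))$, and let $d_{\mathrm{KT}}(\pi,\sigma)$ be the number of pairs of elements that occur in different relative order in $\pi$ and $\sigma$. The Mallows model $M(\phi,\pi^*)$ is the distribution on permutations of $[N]$ with $\Pr[\pi]=\phi^{d_{\mathrm{KT}}(\pi,\pi^*)}/\sum_{\sigma}\phi^{d_{\mathrm{KT}}(\sigma,\pi^*)}$. For permutations $\pi,\hat\pi$ of $[N]$ let $v_\pi^{\leftarrow\hat\pi}\in\mathbb R^N$ (the front adjustment) be the vector whose $i$th entry is the number of $j$ with $\hat\pi^{-1}(j)<\hat\pi^{-1}(i)$ and $\pi^{-1}(j)>\pi^{-1}(i)$, and let $v_\pi^{\rightarrow\hat\pi}\in\mathbb R^N$ (the back adjustment) be the vector whose $i$th entry is the number of $j$ with $\hat\pi^{-1}(j)>\hat\pi^{-1}(i)$ and $\pi^{-1}(j)<\pi^{-1}(i)$. **Lemma.** There is a universal constant $C>0$ such that the following holds. Let $n\ge 1$, $0<\varepsilon<1/10$,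 $0<\phi<1$, and put $\theta=\lceil 10^3\log(n/\varepsilon)/(1-\phi)\rceil$. For $v\in\mathbb R^{n+2\theta}$ let $\mathrm{trunc}(v)\in\mathbb R^n$ be obtained from $v$ by deleting its first $\theta$ and last $\theta$ entries. Let $\hat\pi$ and $\pi^*$ be permutations of $[n+2\theta]$ with $\hat\pi(k)=\pi^*(k)=k$ for all $k\le\theta$ and all $k>n+\theta$, and suppose that $$\|v_{\hat\pi}-v_{\pi^*}\|_2\le\frac{1}{10(1-\phi)}.$$ Then $$\left\|\operatorname{Cov}_{\pi\sim M(\phi,\pi^*)}\left(\frac{1-\phi}{\sqrt\phi}\,\mathrm{trunc}\big(v_\pi^{\leftarrow\hat\pi}\big)\right)-I\right\|_{\mathrm{op}}\le\varepsilon+C\,\|v_{\hat\pi}-v_{\pi^*}\|_2\,(1-\phi),$$ and the same inequality holds with $v_\pi^{\rightarrow\hat\pi}$ in place of $v_\pi^{\leftarrow\hat\pi}$. -/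

import Mathlib

open scoped BigOperators

noncomputable section

namespace Mallows

/-- Position vector of a permutation `π` of `[N]`: its `i`-th entry is the (1-based) position of the
element `i`. Permutations are bijections from positions to elements, so this is `π⁻¹(i)`. -/
def posVec {N : ℕ} (π : Equiv.Perm (Fin N)) : EuclideanSpace ℝ (Fin N) :=
  WithLp.toLp 2 fun i => ((π.symm i : ℕ) : ℝ) + 1

/-- Kendall-tau distance: the number of pairs `x < y` of elements whose relative order differs
in `π` and `σ`. -/
def kendallTau {N : ℕ} (π σ : Equiv.Perm (Fin N)) : ℕ :=
  (Finset.univ.filter fun p : Fin N × Fin N =>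
    p.1 < p.2 ∧ ¬ (π.symm p.1 < π.symm p.2 ↔ σ.symm p.1 < σ.symm p.2)).card

/-- The normalizing constant of the Mallows model. -/
def partitionFn {N : ℕ} (φ : ℝ) (πstar : Equiv.Perm (Fin N)) : ℝ :=
  ∑ π : Equiv.Perm (Fin N), φ ^ kendallTau π πstar

/-- The probability of `π` under the Mallows model `M(φ, πstar)`. -/
def prob {N : ℕ} (φ : ℝ) (πstar π : Equiv.Perm (Fin N)) : ℝ :=
  φ ^ kendallTau π πstar / partitionFn φ πstar

/-- Expectation of a real function of `π ∼ M(φ, πstar)`. -/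
def expect {N : ℕ} (φ : ℝ) (πstar : Equiv.Perm (Fin N)) (f : Equiv.Perm (Fin N) → ℝ) : ℝ :=
  ∑ π : Equiv.Perm (Fin N), prob φ πstar π * f π

/-- Covariance matrix of the random vector `X π`, where `π ∼ M(φ, πstar)`. -/
def covMatrix {N d : ℕ} (φ : ℝ) (πstar : Equiv.Perm (Fin N))
    (X : Equiv.Perm (Fin N) → EuclideanSpace ℝ (Fin d)) : Matrix (Fin d) (Fin d) ℝ :=
  Matrix.of fun i j =>
    expect φ πstar fun π =>
      (X π i - expect φ πstar fun τ => X τ i) * (X π j - expect φ πstar fun τ => X τ j)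

/-- Front adjustment of the position vector of `π` with respect to `πhat`: the `i`-th entry is the
number of elements that come before `i` in `πhat` and after `i` in `π`. -/
def frontAdj {N : ℕ} (πhat π : Equiv.Perm (Fin N)) : EuclideanSpace ℝ (Fin N) :=
  WithLp.toLp 2 fun i =>
    ((Finset.univ.filter fun j : Fin N =>
      πhat.symm j < πhat.symm i ∧ π.symm i < π.symm j).card : ℝ)

/-- Back adjustment of the position vector of `π` with respect to `πhat`: the `i`-th entry is the
number of elements that come after `i` in `πhat` and before `i` in `π`. -/
def backAdj {N : ℕ} (πhat π : Equiv.Perm (Fin N)) : EuclideanSpace ℝ (Fin N) :=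
  WithLp.toLp 2 fun i =>
    ((Finset.univ.filter fun j : Fin N =>
      πhat.symm i < πhat.symm j ∧ π.symm j < π.symm i).card : ℝ)

/-- The length `θ = ⌈10³ log(n/ε) / (1 - φ)⌉` of the padding on either side. -/
def padLen (n : ℕ) (ε φ : ℝ) : ℕ :=
  ⌈10 ^ 3 * Real.log ((n : ℝ) / ε) / (1 - φ)⌉₊

/-- Deletion of the first `θ` and the last `θ` entries of a vector. -/
def trunc {n θ : ℕ} (v : EuclideanSpace ℝ (Fin (n + 2 * θ))) : EuclideanSpace ℝ (Fin n) :=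
  WithLp.toLp 2 fun i => v ⟨(i : ℕ) + θ, by have := i.isLt; omega⟩

/-- The permutation agrees with the identity in the first `θ` and in the last `θ` positions. -/
def MatchesIdAtEnds {n θ : ℕ} (π : Equiv.Perm (Fin (n + 2 * θ))) : Prop :=
  ∀ k : Fin (n + 2 * θ), ((k : ℕ) < θ ∨ n + θ ≤ (k : ℕ)) → π k = k

/-- The `ℓ²` operator norm of a real square matrix. -/
def opNorm {d : ℕ} (A : Matrix (Fin d) (Fin d) ℝ) : ℝ :=
  ‖Matrix.toEuclideanCLM (n := Fin d) (𝕜 := ℝ) A‖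

theorem partitionFn_pos {N : ℕ} {φ : ℝ} (hφ : 0 < φ) (πstar : Equiv.Perm (Fin N)) :
    0 < partitionFn φ πstar :=
  Finset.sum_pos (fun _ _ => pow_pos hφ _) Finset.univ_nonempty

theorem prob_nonneg {N : ℕ} {φ : ℝ} (hφ : 0 < φ) (πstar π : Equiv.Perm (Fin N)) :
    0 ≤ prob φ πstar π :=
  div_nonneg (pow_nonneg hφ.le _) (partitionFn_pos hφ πstar).le

theorem sum_prob {N : ℕ} {φ : ℝ} (hφ : 0 < φ) (πstar : Equiv.Perm (Fin N)) :
    ∑ π : Equiv.Perm (Fin N), prob φ πstar π = 1 := by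
  unfold prob
  rw [← Finset.sum_div]
  exact div_self (partitionFn_pos hφ πstar).ne'

end Mallows

end

/-! When `πhat = πstar`, the front adjustment is the inversion table of `π` relative to `πstar`. The
table is a bijection from permutations onto a product of intervals, and its entries sum to the
Kendall-tau distance. Under the Mallows model the entries are therefore independent truncated
geometric variables, and the covariance is diagonal. An element at position `m` (counted from 1) has
variance `φ/(1-φ)² - m²φ^m/(1-φ^m)²`. After scaling this is 1 minus a term that the padding `m > θ`
makes at most `ε`.

For general `πhat`, put `D = ‖posVec πhat - posVec πstar‖`. For every fixed `π`, replacing `πstar`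
by `πhat` changes entry `i` by at most the number of inversions between `πhat` and `πstar` at `i`,
taken in one of the two directions. The inversions at `i` have distinct positive lengths, and
Spearman's identity equates twice the total length with `D²`, so these counts have ℓ² norm at most
`D`. The adjustment thus moves by at most `√2 D` for every `π`, and Cauchy–Schwarz bounds the effect
on the covariance with no independence assumption on the perturbation. Reversing all permutations
turns the back adjustment into the front one. -/

namespace Mallows

/-! ### Inversion counts and Spearman displacement -/

section Displacement

variable {N : ℕ}

theorem card_filter_lt_apply (q : Equiv.Perm (Fin N)) (i : Fin N) :
    (Finset.univ.filter fun j => q j < q i).card = (q i : ℕ) := by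
  rw [← Fin.card_Iio (q i)]
  refine Finset.card_bij (fun j _ => q j) (by simp) (by simp) ?_
  intro b hb
  exact ⟨q.symm b, by simpa using hb, by simp⟩

/-- The elements that come after `i` in the order `q` and before `i` in the order `p`. -/
def invSet (q p : Equiv.Perm (Fin N)) (i : Fin N) : Finset (Fin N) :=
  Finset.univ.filter fun j => q i < q j ∧ p j < p i

theorem mem_invSet {q p : Equiv.Perm (Fin N)} {i j : Fin N} :
    j ∈ invSet q p i ↔ q i < q j ∧ p j < p i := by simp [invSet]

/-- The elements that precede `i` in both orders contribute equally to the ranks `p i` and `q i`,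
and cancel. -/
theorem card_invSet_sub (q p : Equiv.Perm (Fin N)) (i : Fin N) :
    ((invSet q p i).card : ℤ) - (invSet p q i).card = (p i : ℤ) - q i := by
  have h1 : (Finset.univ.filter fun j => p j < p i).card
      = (invSet q p i).card + (Finset.univ.filter fun j => p j < p i ∧ q j < q i).card := by
    rw [← Finset.card_filter_add_card_filter_not (s := Finset.univ.filter fun j => p j < p i)
      (fun j => q i < q j), Finset.filter_filter, Finset.filter_filter]
    congr 2
    · ext j; simp [invSet, and_comm]
    · ext j
      simp only [Finset.mem_filter, Finset.mem_univ, true_and, not_lt]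
      refine and_congr_right fun h => ⟨fun h' => lt_of_le_of_ne h' ?_, le_of_lt⟩
      intro e; rw [q.injective e] at h; exact lt_irrefl _ h
  have h2 : (Finset.univ.filter fun j => q j < q i).card
      = (invSet p q i).card + (Finset.univ.filter fun j => p j < p i ∧ q j < q i).card := by
    rw [← Finset.card_filter_add_card_filter_not (s := Finset.univ.filter fun j => q j < q i)
      (fun j => p i < p j), Finset.filter_filter, Finset.filter_filter]
    congr 2
    · ext j; simp [invSet, and_comm]
    · ext j
      simp only [Finset.mem_filter, Finset.mem_univ, true_and, not_lt]
      rw [and_comm]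
      refine and_congr_left fun h => ⟨fun h' => lt_of_le_of_ne h' ?_, le_of_lt⟩
      intro e; rw [p.injective e] at h; exact lt_irrefl _ h
  rw [card_filter_lt_apply] at h1 h2
  omega

/-- The Spearman identity: the squared displacement is twice the sum of the lengths of the
inversions. -/
theorem sum_sq_displacement (q p : Equiv.Perm (Fin N)) :
    ∑ i, ((p i : ℤ) - q i) ^ 2 = 2 * ∑ i, ∑ j ∈ invSet q p i, ((q j : ℤ) - q i) := by
  have hsq : ∑ i, ((p i : ℤ)) ^ 2 = ∑ i, ((q i : ℤ)) ^ 2 := by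
    rw [Equiv.sum_comp p fun k : Fin N => ((k : ℤ)) ^ 2,
      Equiv.sum_comp q fun k : Fin N => ((k : ℤ)) ^ 2]
  -- Each inversion is recounted from its other endpoint.
  have hswap : ∑ i, ∑ j ∈ invSet q p i, (q j : ℤ) = ∑ j, ∑ i ∈ invSet p q j, (q j : ℤ) := by
    refine Finset.sum_comm' fun i j => ?_
    simp [mem_invSet, and_comm]
  have h1 : ∑ i, ∑ j ∈ invSet q p i, ((q j : ℤ) - q i) = - ∑ i, (q i : ℤ) * ((p i : ℤ) - q i) := by
    simp only [Finset.sum_sub_distrib]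
    rw [hswap, ← Finset.sum_sub_distrib, ← Finset.sum_neg_distrib]
    refine Finset.sum_congr rfl fun i _ => ?_
    rw [← card_invSet_sub]
    simp only [Finset.sum_const, nsmul_eq_mul]
    ring
  rw [h1]
  have h2 : ∑ i, ((p i : ℤ) - q i) ^ 2 + 2 * ∑ i, (q i : ℤ) * ((p i : ℤ) - q i)
      = ∑ i, ((p i : ℤ)) ^ 2 - ∑ i, ((q i : ℤ)) ^ 2 := by
    rw [Finset.mul_sum, ← Finset.sum_add_distrib, ← Finset.sum_sub_distrib]
    exact Finset.sum_congr rfl fun i _ => by ring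
  linarith

/-- Among positive integers, `k` distinct ones sum to at least `1 + ⋯ + k ≥ k²/2`. In the induction,
the new maximum is at least the new cardinality. -/
theorem card_sq_le_two_mul_sum (s : Finset ℤ) (hs : ∀ x ∈ s, 1 ≤ x) :
    ((s.card : ℤ)) ^ 2 ≤ 2 * ∑ x ∈ s, x := by
  induction s using Finset.induction_on_max with
  | empty => simp
  | insert a s ha ih =>
    have hna : a ∉ s := fun h => lt_irrefl _ (ha a h)
    rw [Finset.card_insert_of_notMem hna, Finset.sum_insert hna]
    have hc : ((s.card : ℤ)) + 1 ≤ a := by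
      have hsub : insert a s ⊆ Finset.Icc 1 a := by
        intro x hx
        rw [Finset.mem_Icc]
        refine ⟨hs x hx, ?_⟩
        rcases Finset.mem_insert.1 hx with rfl | h
        · exact le_rfl
        · exact (ha x h).le
      have := Finset.card_le_card hsub
      rw [Finset.card_insert_of_notMem hna, Int.card_Icc] at this
      have := hs a (Finset.mem_insert_self _ _)
      omega
    have := ih fun x hx => hs x (Finset.mem_insert_of_mem hx)
    push_cast
    nlinarith

/-- At each `i` the lengths `q j - q i` are distinct positive integers, so the squared count is at
most twice their sum; Spearman's identity totals these. -/
theorem sum_card_invSet_sq_le (q p : Equiv.Perm (Fin N)) :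
    ∑ i, ((invSet q p i).card : ℤ) ^ 2 ≤ ∑ i, ((p i : ℤ) - q i) ^ 2 := by
  rw [sum_sq_displacement, Finset.mul_sum]
  refine Finset.sum_le_sum fun i _ => ?_
  have hinj : Set.InjOn (fun j => (q j : ℤ) - q i) (invSet q p i) := by
    intro a _ b _ h
    have : (q a : ℤ) = q b := by simpa using h
    exact q.injective (Fin.ext (by exact_mod_cast this))
  have := card_sq_le_two_mul_sum ((invSet q p i).image fun j => (q j : ℤ) - q i) (by
    intro x hx
    obtain ⟨j, hj, rfl⟩ := Finset.mem_image.1 hx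
    have := (mem_invSet.1 hj).1
    rw [Fin.lt_def] at this
    omega)
  rwa [Finset.card_image_of_injOn hinj, Finset.sum_image hinj] at this

theorem norm_posVec_sub_sq (π σ : Equiv.Perm (Fin N)) :
    ‖posVec π - posVec σ‖ ^ 2 = ∑ i, (((π.symm i : ℕ) : ℝ) - (σ.symm i : ℕ)) ^ 2 := by
  rw [EuclideanSpace.norm_sq_eq]
  simp [posVec, sq_abs]

/-- Positions are integers. With the upper bound on the displacement, this forces `φ` near 1 unless
the two permutations coincide. -/
theorem one_le_norm_posVec_sub {π σ : Equiv.Perm (Fin N)} (h : π ≠ σ) :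
    1 ≤ ‖posVec π - posVec σ‖ := by
  have hs : π.symm ≠ σ.symm := fun e => h (by simpa using congrArg Equiv.symm e)
  obtain ⟨i, hi⟩ : ∃ i, π.symm i ≠ σ.symm i := by
    by_contra! hc
    exact hs (Equiv.ext hc)
  have h1 : (1 : ℝ) ≤ (((π.symm i : ℕ) : ℝ) - (σ.symm i : ℕ)) ^ 2 := by
    have hz : ((π.symm i : ℕ) : ℤ) - (σ.symm i : ℕ) ≠ 0 := by
      rw [Ne, Fin.ext_iff] at hi
      omega
    have : (1 : ℤ) ≤ (((π.symm i : ℕ) : ℤ) - (σ.symm i : ℕ)) ^ 2 := by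
      have := sq_pos_of_ne_zero hz
      omega
    exact_mod_cast this
  have h2 := Finset.single_le_sum (f := fun i => (((π.symm i : ℕ) : ℝ) - (σ.symm i : ℕ)) ^ 2)
    (fun _ _ => sq_nonneg _) (Finset.mem_univ i)
  rw [← norm_posVec_sub_sq] at h2
  nlinarith [norm_nonneg (posVec π - posVec σ)]

theorem frontAdj_apply (πhat π : Equiv.Perm (Fin N)) (i : Fin N) :
    frontAdj πhat π i = ((invSet π.symm πhat.symm i).card : ℝ) := by
  simp [frontAdj, invSet, and_comm]

/-- If the reference order changes from `q` to `p`, the number of inversions of `r` at `i` changes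
by at most the number of inversions between `p` and `q` at `i`. -/
theorem card_invSet_le_add (r p q : Equiv.Perm (Fin N)) (i : Fin N) :
    (invSet r p i).card ≤ (invSet r q i).card + (invSet q p i).card := by
  refine (Finset.card_le_card ?_).trans (Finset.card_union_le _ _)
  intro j hj
  rw [Finset.mem_union, mem_invSet, mem_invSet]
  rw [mem_invSet] at hj
  rcases lt_trichotomy (q i) (q j) with h | h | h
  · exact Or.inr ⟨h, hj.2⟩
  · rw [q.injective h] at hj
    exact absurd hj.1 (lt_irrefl _)
  · exact Or.inl ⟨hj.1, h⟩

/-- Each entry of the difference is bounded in absolute value by one of the two inversion counts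
between `πhat` and `πstar`, so its square is at most the sum of their squares. The factor 2 accounts
for both directions. -/
theorem norm_frontAdj_sub_sq_le (πhat πstar π : Equiv.Perm (Fin N)) :
    ‖frontAdj πhat π - frontAdj πstar π‖ ^ 2 ≤ 2 * ‖posVec πhat - posVec πstar‖ ^ 2 := by
  have hA := sum_card_invSet_sq_le πstar.symm πhat.symm
  have hB := sum_card_invSet_sq_le πhat.symm πstar.symm
  have hA' : ∑ i, ((invSet πstar.symm πhat.symm i).card : ℝ) ^ 2
      ≤ ∑ i, (((πhat.symm i : ℕ) : ℝ) - (πstar.symm i : ℕ)) ^ 2 := by exact_mod_cast hA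
  have hB' : ∑ i, ((invSet πhat.symm πstar.symm i).card : ℝ) ^ 2
      ≤ ∑ i, (((πstar.symm i : ℕ) : ℝ) - (πhat.symm i : ℕ)) ^ 2 := by exact_mod_cast hB
  rw [← norm_posVec_sub_sq] at hA' hB'
  rw [norm_sub_rev] at hB'
  rw [EuclideanSpace.norm_sq_eq]
  refine le_trans (Finset.sum_le_sum (g := fun i => ((invSet πstar.symm πhat.symm i).card : ℝ) ^ 2
    + ((invSet πhat.symm πstar.symm i).card : ℝ) ^ 2) fun i _ => ?_) ?_
  · rw [PiLp.sub_apply, frontAdj_apply, frontAdj_apply, Real.norm_eq_abs, sq_abs]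
    have h1 := card_invSet_le_add π.symm πhat.symm πstar.symm i
    have h2 := card_invSet_le_add π.symm πstar.symm πhat.symm i
    have h1' : ((invSet π.symm πhat.symm i).card : ℝ) ≤ (invSet π.symm πstar.symm i).card
      + (invSet πstar.symm πhat.symm i).card := by exact_mod_cast h1
    have h2' : ((invSet π.symm πstar.symm i).card : ℝ) ≤ (invSet π.symm πhat.symm i).card
      + (invSet πhat.symm πstar.symm i).card := by exact_mod_cast h2
    have h3 : (0 : ℝ) ≤ (invSet πstar.symm πhat.symm i).card := Nat.cast_nonneg _
    have h4 : (0 : ℝ) ≤ (invSet πhat.symm πstar.symm i).card := Nat.cast_nonneg _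
    rcases le_total ((invSet π.symm πstar.symm i).card : ℝ) (invSet π.symm πhat.symm i).card with h | h
    · nlinarith
    · nlinarith
  · rw [Finset.sum_add_distrib]
    linarith

end Displacement


/-! ### Independence of the inversion table entries -/

section InversionTable

variable {N : ℕ}

/-- Each discordant pair is charged to whichever of its elements comes later in `σ`, hence earlier
in `π`. -/
theorem kendallTau_eq_sum_card_invSet (π σ : Equiv.Perm (Fin N)) :
    kendallTau π σ = ∑ i, (invSet π.symm σ.symm i).card := by
  have h : ∑ i, (invSet π.symm σ.symm i).card = (Finset.univ.filter fun x : Fin N × Fin N =>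
      π.symm x.1 < π.symm x.2 ∧ σ.symm x.2 < σ.symm x.1).card := by
    rw [Finset.card_filter, Fintype.sum_prod_type]
    simp only [invSet, Finset.card_filter]
  rw [h]
  refine Finset.card_bij'
    (fun x _ => if π.symm x.1 < π.symm x.2 then x else x.swap)
    (fun x _ => if x.1 < x.2 then x else x.swap) ?_ ?_ ?_ ?_
  all_goals
    rintro ⟨a, b⟩ hx
    simp only [Finset.mem_filter, Finset.mem_univ, true_and] at hx
  · have h1 : π.symm a ≠ π.symm b := fun e => hx.1.ne (π.symm.injective e)
    have h2 : σ.symm a ≠ σ.symm b := fun e => hx.1.ne (σ.symm.injective e)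
    by_cases h : π.symm a < π.symm b
    · simp only [h, if_true, Finset.mem_filter, Finset.mem_univ, true_and]
      grind
    · simp only [h, if_false, Finset.mem_filter, Finset.mem_univ, true_and, Prod.swap]
      grind
  · have h1 : a ≠ b := by rintro rfl; exact lt_irrefl _ hx.1
    by_cases h : a < b
    · simp only [h, if_true, Finset.mem_filter, Finset.mem_univ, true_and]
      grind
    · simp only [h, if_false, Finset.mem_filter, Finset.mem_univ, true_and, Prod.swap]
      grind
  · by_cases h : π.symm a < π.symm b
    · simp [h, hx.1]
    · simp [h, hx.1.not_gt]
  · by_cases h : a < b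
    · simp [h, hx.1]
    · simp [h, hx.1.not_gt]

theorem card_invSet_le (r q : Equiv.Perm (Fin N)) (i : Fin N) :
    (invSet r q i).card ≤ q i := by
  rw [← card_filter_lt_apply q i]
  refine Finset.card_le_card fun j hj => ?_
  simpa using (mem_invSet.1 hj).2

/-- The inversion table with respect to a fixed order determines the permutation. -/
theorem card_invSet_injective (q : Equiv.Perm (Fin N)) :
    Function.Injective fun (r : Equiv.Perm (Fin N)) (i : Fin N) => (invSet r q i).card := by
  intro r r' h
  -- Induction on the initial segments of the order `q`: the table determines the relative order of
  -- the first `m` elements.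
  have key : ∀ m : ℕ, ∀ a b : Fin N, (q a : ℕ) < m → (q b : ℕ) < m → (r a < r b ↔ r' a < r' b) := by
    intro m
    induction m with
    | zero => intro a b ha; omega
    | succ m ih =>
      -- By the induction hypothesis, both sets are upper sets of the same linear order on the first
      -- `m` elements. They are thus nested, and equal cardinality makes them equal.
      have hset : ∀ c : Fin N, (q c : ℕ) = m → invSet r q c = invSet r' q c := by
        intro c hc
        have hcard : (invSet r q c).card = (invSet r' q c).card := congrFun h c
        by_cases hsub : invSet r q c ⊆ invSet r' q c
        · exact Finset.eq_of_subset_of_card_le hsub hcard.ge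
        · obtain ⟨x, hx, hx'⟩ := Finset.not_subset.1 hsub
          have hsub' : invSet r' q c ⊆ invSet r q c := by
            intro y hy
            rw [mem_invSet] at hx hx' hy ⊢
            refine ⟨?_, hy.2⟩
            have hxq : (q x : ℕ) < m := by rw [← hc]; exact hx.2
            have hyq : (q y : ℕ) < m := by rw [← hc]; exact hy.2
            have h1 : r' x ≤ r' c := by
              by_contra! hlt
              exact hx' ⟨hlt, hx.2⟩
            exact hx.1.trans ((ih x y hxq hyq).2 (h1.trans_lt hy.1))
          exact (Finset.eq_of_subset_of_card_le hsub' hcard.le).symm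
      intro a b ha hb
      have hr : ∀ c d : Fin N, r c = r d ↔ r' c = r' d := fun c d => by simp
      have hmem : ∀ c d : Fin N, (q c : ℕ) = m → (q d : ℕ) < m → (r c < r d ↔ r' c < r' d) := by
        intro c d hc hd
        have hdc : q d < q c := by rw [Fin.lt_def]; omega
        have := Finset.ext_iff.1 (hset c hc) d
        simpa [mem_invSet, hdc] using this
      rcases Nat.lt_succ_iff_lt_or_eq.1 ha with ha' | ha' <;>
        rcases Nat.lt_succ_iff_lt_or_eq.1 hb with hb' | hb'
      · exact ih a b ha' hb'
      · have := hmem b a hb' ha'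
        have := hr a b
        grind
      · exact hmem a b ha' hb'
      · have : a = b := q.injective (Fin.ext (ha'.trans hb'.symm))
        simp [this]
  have hmono : StrictMono fun k => r' (r.symm k) := by
    intro a b hab
    refine (key N _ _ (q _).isLt (q _).isLt).1 ?_
    simpa using hab
  have hmono' : StrictMono fun k => r (r'.symm k) := by
    intro a b hab
    refine (key N _ _ (q _).isLt (q _).isLt).2 ?_
    simpa using hab
  -- The permutations `r` and `r'` now induce the same order, so `r'` composed with the inverse of
  -- `r` is an order automorphism of `Fin N`, hence the identity.
  let e : Fin N ≃o Fin N := StrictMono.orderIsoOfRightInverse _ hmono (fun k => r (r'.symm k))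
    (fun k => by simp)
  have he : e = OrderIso.refl _ := Subsingleton.elim _ _
  ext i
  have := congrArg (fun f : Fin N ≃o Fin N => f (r i)) he
  simp [e] at this
  rw [this]

/-- Injectivity suffices, since both sides have `N!` elements. -/
theorem image_card_invSet (q : Equiv.Perm (Fin N)) :
    (Finset.univ.image fun (r : Equiv.Perm (Fin N)) (i : Fin N) => (invSet r q i).card)
      = Fintype.piFinset fun i => Finset.range ((q i : ℕ) + 1) := by
  refine Finset.eq_of_subset_of_card_le ?_ ?_
  · intro x hx
    obtain ⟨r, -, rfl⟩ := Finset.mem_image.1 hx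
    rw [Fintype.mem_piFinset]
    intro i
    exact Finset.mem_range.2 (Nat.lt_succ_of_le (card_invSet_le r q i))
  · rw [Finset.card_image_of_injective _ (card_invSet_injective q), Finset.card_univ,
      Fintype.card_perm, Fintype.card_piFinset, Fintype.card_fin]
    simp only [Finset.card_range]
    rw [Equiv.prod_comp q fun k : Fin N => (k : ℕ) + 1,
      Fin.prod_univ_eq_prod_range fun k => k + 1, Finset.prod_range_add_one_eq_factorial]

/-- The entries of the inversion table are independent with geometric weights. -/
theorem sum_pow_kendallTau_mul_prod (φ : ℝ) (σ : Equiv.Perm (Fin N)) (F : Fin N → ℕ → ℝ) :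
    ∑ π : Equiv.Perm (Fin N), φ ^ kendallTau π σ * ∏ i, F i (invSet π.symm σ.symm i).card
      = ∏ i, ∑ k ∈ Finset.range ((σ.symm i : ℕ) + 1), φ ^ k * F i k := by
  rw [Finset.prod_univ_sum, ← image_card_invSet,
    Finset.sum_image fun _ _ _ _ h => card_invSet_injective _ h,
    ← Equiv.sum_comp (Equiv.inv (Equiv.Perm (Fin N)))]
  refine Finset.sum_congr rfl fun π _ => ?_
  rw [kendallTau_eq_sum_card_invSet, ← Finset.prod_pow_eq_pow_sum, ← Finset.prod_mul_distrib]
  rfl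

/-- Expectation of `f` under the geometric distribution conditioned on `{0, …, m - 1}`. -/
noncomputable def truncGeomMean (φ : ℝ) (m : ℕ) (f : ℕ → ℝ) : ℝ :=
  (∑ k ∈ Finset.range m, φ ^ k * f k) / ∑ k ∈ Finset.range m, φ ^ k

theorem truncGeomMean_one {φ : ℝ} (hφ : 0 < φ) {m : ℕ} (hm : 0 < m) :
    truncGeomMean φ m (fun _ => 1) = 1 := by
  simp only [truncGeomMean, mul_one]
  exact div_self (Finset.sum_pos (fun _ _ => pow_pos hφ _) (by simpa using hm.ne')).ne'

/-- This is independence in functional form. Normalization comes from the same product formula with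
every factor function equal to 1. -/
theorem expect_prod {φ : ℝ} (σ : Equiv.Perm (Fin N)) (F : Fin N → ℕ → ℝ) :
    expect φ σ (fun π => ∏ i, F i (invSet π.symm σ.symm i).card)
      = ∏ i, truncGeomMean φ ((σ.symm i : ℕ) + 1) (F i) := by
  have hZ : partitionFn φ σ = ∏ i, ∑ k ∈ Finset.range ((σ.symm i : ℕ) + 1), φ ^ k := by
    have := sum_pow_kendallTau_mul_prod φ σ fun _ _ => 1
    simpa [partitionFn] using this
  simp only [expect, prob, truncGeomMean]
  rw [Finset.prod_div_distrib, ← hZ, ← sum_pow_kendallTau_mul_prod, Finset.sum_div]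
  exact Finset.sum_congr rfl fun π _ => by ring

theorem expect_single {φ : ℝ} (hφ : 0 < φ) (σ : Equiv.Perm (Fin N)) (i : Fin N) (f : ℕ → ℝ) :
    expect φ σ (fun π => f (invSet π.symm σ.symm i).card)
      = truncGeomMean φ ((σ.symm i : ℕ) + 1) f := by
  have h := expect_prod (φ := φ) σ fun l k => if l = i then f k else 1
  simp only [Finset.prod_ite_eq', Finset.mem_univ, if_true] at h
  rw [h, Finset.prod_eq_single i]
  · simp
  · intro l _ hl
    simp only [hl, if_false]
    exact truncGeomMean_one hφ (Nat.succ_pos _)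
  · simp

theorem expect_mul_of_ne {φ : ℝ} (hφ : 0 < φ) (σ : Equiv.Perm (Fin N)) {i j : Fin N} (hij : i ≠ j)
    (f g : ℕ → ℝ) :
    expect φ σ (fun π => f (invSet π.symm σ.symm i).card * g (invSet π.symm σ.symm j).card)
      = truncGeomMean φ ((σ.symm i : ℕ) + 1) f * truncGeomMean φ ((σ.symm j : ℕ) + 1) g := by
  have h := expect_prod (φ := φ) σ
    fun l k => (if l = i then f k else 1) * (if l = j then g k else 1)
  simp only [Finset.prod_mul_distrib, Finset.prod_ite_eq', Finset.mem_univ, if_true] at h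
  rw [h, Finset.prod_eq_mul i j hij]
  · simp [hij, hij.symm]
  · rintro l _ ⟨hl, hl'⟩
    simp only [hl, hl', if_false, mul_one]
    exact truncGeomMean_one hφ (Nat.succ_pos _)
  · simp
  · simp

end InversionTable

/-! ### Moments of the truncated geometric distribution -/

section TruncatedGeometric

theorem sum_pow_mul_id {φ : ℝ} (hφ : φ ≠ 1) (m : ℕ) :
    ∑ k ∈ Finset.range m, φ ^ k * (k : ℝ)
      = (φ - m * φ ^ m + (m - 1) * φ ^ (m + 1)) / (1 - φ) ^ 2 := by
  have h : 1 - φ ≠ 0 := sub_ne_zero.2 hφ.symm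
  induction m with
  | zero => simp
  | succ m ih =>
    rw [Finset.sum_range_succ, ih]
    push_cast
    field_simp
    ring

theorem sum_pow_mul_sq {φ : ℝ} (hφ : φ ≠ 1) (m : ℕ) :
    ∑ k ∈ Finset.range m, φ ^ k * (k : ℝ) ^ 2
      = (φ * (1 + φ) - φ ^ m * ((m : ℝ) ^ 2 - (2 * m ^ 2 - 2 * m - 1) * φ + (m - 1) ^ 2 * φ ^ 2))
        / (1 - φ) ^ 3 := by
  have h : 1 - φ ≠ 0 := sub_ne_zero.2 hφ.symm
  induction m with
  | zero => simp; ring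
  | succ m ih =>
    rw [Finset.sum_range_succ, ih]
    push_cast
    field_simp
    ring

/-- Variance of the geometric distribution conditioned on `{0, …, m - 1}`. -/
theorem truncGeom_variance {φ : ℝ} (h0 : 0 < φ) (h1 : φ < 1) {m : ℕ} (hm : 0 < m) :
    truncGeomMean φ m (fun k => ((k : ℝ) - truncGeomMean φ m fun k => (k : ℝ)) ^ 2)
      = φ / (1 - φ) ^ 2 - (m : ℝ) ^ 2 * φ ^ m / (1 - φ ^ m) ^ 2 := by
  have hφ : φ ≠ 1 := h1.ne
  have h : 1 - φ ≠ 0 := sub_ne_zero.2 hφ.symm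
  have h' : 1 - φ ^ m ≠ 0 := (sub_pos.2 (pow_lt_one₀ h0.le h1 hm.ne')).ne'
  have hS : ∑ k ∈ Finset.range m, φ ^ k = (1 - φ ^ m) / (1 - φ) := by
    rw [geom_sum_eq hφ, ← neg_div_neg_eq]
    ring
  have hmu : truncGeomMean φ m (fun k => (k : ℝ))
      = (φ - m * φ ^ m + (m - 1) * φ ^ (m + 1)) / ((1 - φ) * (1 - φ ^ m)) := by
    rw [truncGeomMean, sum_pow_mul_id hφ, hS]
    field_simp
  generalize hμ : truncGeomMean φ m (fun k => (k : ℝ)) = μ at *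
  have hexp : ∑ k ∈ Finset.range m, φ ^ k * ((k : ℝ) - μ) ^ 2
      = ∑ k ∈ Finset.range m, φ ^ k * (k : ℝ) ^ 2 - 2 * μ * ∑ k ∈ Finset.range m, φ ^ k * (k : ℝ)
        + μ ^ 2 * ∑ k ∈ Finset.range m, φ ^ k := by
    rw [Finset.mul_sum, Finset.mul_sum, ← Finset.sum_sub_distrib, ← Finset.sum_add_distrib]
    exact Finset.sum_congr rfl fun k _ => by ring
  rw [truncGeomMean, hexp, sum_pow_mul_id hφ, sum_pow_mul_sq hφ, hS, hmu, pow_succ φ m]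
  -- With `φ ^ m` as a free variable, what remains is an identity of rational functions.
  generalize φ ^ m = y at *
  field_simp
  ring

/-- The relative deviation of the variance from that of the full geometric distribution. -/
theorem truncGeom_deviation_le {φ L : ℝ} (h0 : 0 < φ) (h1 : φ < 1) (hL : 1 ≤ L) {t : ℕ}
    (ht : 10 ^ 3 * L / (1 - φ) ≤ t) :
    (1 - φ) ^ 2 * ((t + 1 : ℕ) : ℝ) ^ 2 * φ ^ t / (1 - φ ^ (t + 1)) ^ 2 ≤ Real.exp (-L) := by
  have hp : 0 < 1 - φ := sub_pos.2 h1
  -- In terms of `x`, the numerator is at most `(x+1)² exp(-x) ≤ 16 exp(-x/2)` and the denominator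
  -- is at least `1/4`.
  set x : ℝ := t * (1 - φ) with hx
  have hxL : 10 ^ 3 * L ≤ x := (div_le_iff₀ hp).1 ht
  have hpow : φ ^ t ≤ Real.exp (-x) := by
    have : φ ≤ Real.exp (-(1 - φ)) := by
      have := Real.add_one_le_exp (-(1 - φ))
      linarith
    calc φ ^ t ≤ Real.exp (-(1 - φ)) ^ t := pow_le_pow_left₀ h0.le this t
      _ = Real.exp (-x) := by rw [← Real.exp_nat_mul, hx]; ring_nf
  have hx1 : x + 1 ≤ 4 * Real.exp (x / 4) := by
    have := Real.add_one_le_exp (x / 4)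
    linarith
  have hsmall : Real.exp (-x) ≤ 1 / 2 := by
    rw [Real.exp_neg]
    have := Real.add_one_le_exp x
    rw [one_div]
    exact inv_anti₀ (by norm_num) (by linarith)
  have hden : 1 / 2 ≤ 1 - φ ^ (t + 1) := by
    have : φ ^ (t + 1) ≤ φ ^ t := pow_le_pow_of_le_one h0.le h1.le (Nat.le_succ t)
    linarith
  have hnum : (1 - φ) * ((t + 1 : ℕ) : ℝ) ≤ 4 * Real.exp (x / 4) := by
    push_cast
    rw [hx] at hx1 ⊢
    linarith
  -- Here `64 = 16 · 4` combines the numerator and denominator constants. A factor `exp(x/4)`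
  -- absorbs it because `x ≥ 1000`.
  have h64 : 64 * Real.exp (-(x / 2)) ≤ Real.exp (-L) := by
    have h7 : (64 : ℝ) ≤ Real.exp (x / 4) := by
      have := Real.add_one_le_exp (x / 4)
      linarith
    calc 64 * Real.exp (-(x / 2)) ≤ Real.exp (x / 4) * Real.exp (-(x / 2)) := by gcongr
      _ = Real.exp (-(x / 4)) := by rw [← Real.exp_add]; ring_nf
      _ ≤ Real.exp (-L) := Real.exp_le_exp.2 (by linarith)
  have hn0 : 0 ≤ (1 - φ) * ((t + 1 : ℕ) : ℝ) := by positivity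
  rw [div_le_iff₀ (by positivity)]
  calc (1 - φ) ^ 2 * ((t + 1 : ℕ) : ℝ) ^ 2 * φ ^ t
      = ((1 - φ) * ((t + 1 : ℕ) : ℝ)) ^ 2 * φ ^ t := by ring
    _ ≤ (4 * Real.exp (x / 4)) ^ 2 * Real.exp (-x) := by gcongr
    _ = 16 * Real.exp (-(x / 2)) := by
      rw [mul_pow, ← Real.exp_nat_mul, mul_assoc, ← Real.exp_add]
      norm_num
      ring_nf
    _ ≤ Real.exp (-L) * (1 / 2) ^ 2 := by linarith
    _ ≤ Real.exp (-L) * (1 - φ ^ (t + 1)) ^ 2 := by gcongr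

end TruncatedGeometric


/-! ### Covariance under bounded perturbations -/

section CovariancePerturbation

theorem opNorm_le_of_abs_dotProduct_le {d : ℕ} (A : Matrix (Fin d) (Fin d) ℝ) {c : ℝ} (hc : 0 ≤ c)
    (h : ∀ u v : EuclideanSpace ℝ (Fin d), |∑ i, ∑ j, u i * A i j * v j| ≤ c * ‖u‖ * ‖v‖) :
    opNorm A ≤ c := by
  refine ContinuousLinearMap.opNorm_le_bound _ hc fun v => ?_
  set w := Matrix.toEuclideanCLM (n := Fin d) (𝕜 := ℝ) A v with hw
  have hwi : ∀ i, w i = ∑ j, A i j * v j := fun i => by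
    rw [hw]
    simp [Matrix.mulVec, dotProduct]
  have h1 : ∑ i, ∑ j, w i * A i j * v j = ‖w‖ ^ 2 := by
    rw [EuclideanSpace.real_norm_sq_eq]
    refine Finset.sum_congr rfl fun i _ => ?_
    simp only [mul_assoc]
    rw [← Finset.mul_sum, ← hwi, sq]
  -- Testing the bilinear form at `u = A v` gives `‖A v‖² ≤ c ‖A v‖ ‖v‖`.
  have h2 := h w v
  rw [h1, abs_of_nonneg (sq_nonneg _)] at h2
  rcases (norm_nonneg w).eq_or_lt with h0 | h0
  · rw [← h0]
    positivity
  · nlinarith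

variable {α : Type*} [Fintype α]

/-- Cauchy–Schwarz for a weighted sum, in terms of bounds for the second moments. -/
theorem abs_sum_weight_mul_le {w f g : α → ℝ} (hw : ∀ a, 0 ≤ w a) {s t : ℝ} (hs : 0 ≤ s)
    (ht : 0 ≤ t) (hf : ∑ a, w a * f a ^ 2 ≤ s ^ 2) (hg : ∑ a, w a * g a ^ 2 ≤ t ^ 2) :
    |∑ a, w a * (f a * g a)| ≤ s * t := by
  refine abs_le_of_sq_le_sq ?_ (by positivity)
  have h := Finset.sum_mul_sq_le_sq_mul_sq Finset.univ (fun a => √(w a) * f a)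
    (fun a => √(w a) * g a)
  have e : ∀ p q : α → ℝ, ∀ a, (√(w a) * p a) * (√(w a) * q a) = w a * (p a * q a) :=
    fun p q a => by linear_combination (p a * q a) * Real.mul_self_sqrt (hw a)
  have e2 : ∀ p : α → ℝ, ∀ a, (√(w a) * p a) ^ 2 = w a * p a ^ 2 :=
    fun p a => by rw [mul_pow, Real.sq_sqrt (hw a)]
  simp only [e, e2] at h
  refine h.trans ?_
  rw [mul_pow]
  exact mul_le_mul hf hg (Finset.sum_nonneg fun a _ => mul_nonneg (hw a) (sq_nonneg _))
    (sq_nonneg _)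

theorem sum_weight_centered_sq_le {w : α → ℝ} (h1 : ∑ a, w a = 1) (f : α → ℝ) :
    ∑ a, w a * (f a - ∑ b, w b * f b) ^ 2 ≤ ∑ a, w a * f a ^ 2 := by
  have h : ∀ μ : ℝ, ∑ a, w a * (f a - μ) ^ 2 = ∑ a, w a * f a ^ 2 - 2 * μ * ∑ a, w a * f a
      + μ ^ 2 * ∑ a, w a := by
    intro μ
    rw [Finset.mul_sum, Finset.mul_sum, ← Finset.sum_sub_distrib, ← Finset.sum_add_distrib]
    exact Finset.sum_congr rfl fun a _ => by ring
  rw [h, h1]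
  nlinarith [sq_nonneg (∑ b, w b * f b)]

variable {N d : ℕ}

/-- The linear statistic `⟨u, X⟩`, centered under the Mallows model. -/
noncomputable def centered (φ : ℝ) (σ : Equiv.Perm (Fin N))
    (X : Equiv.Perm (Fin N) → EuclideanSpace ℝ (Fin d)) (u : EuclideanSpace ℝ (Fin d))
    (π : Equiv.Perm (Fin N)) : ℝ :=
  ∑ i, u i * (X π i - expect φ σ fun τ => X τ i)

theorem centered_add (φ : ℝ) (σ : Equiv.Perm (Fin N))
    (X Y : Equiv.Perm (Fin N) → EuclideanSpace ℝ (Fin d)) (u : EuclideanSpace ℝ (Fin d))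
    (π : Equiv.Perm (Fin N)) :
    centered φ σ (fun τ => X τ + Y τ) u π = centered φ σ X u π + centered φ σ Y u π := by
  simp only [centered, expect, PiLp.add_apply, mul_add, Finset.sum_add_distrib]
  rw [← Finset.sum_add_distrib]
  exact Finset.sum_congr rfl fun i _ => by ring

/-- Written this way, the bilinear form of the covariance is a weighted inner product, to which
Cauchy–Schwarz applies. -/
theorem sum_covMatrix (φ : ℝ) (σ : Equiv.Perm (Fin N))
    (X : Equiv.Perm (Fin N) → EuclideanSpace ℝ (Fin d)) (u v : EuclideanSpace ℝ (Fin d)) :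
    ∑ i, ∑ j, u i * covMatrix φ σ X i j * v j
      = ∑ π, prob φ σ π * (centered φ σ X u π * centered φ σ X v π) := by
  have hmul : ∀ π, prob φ σ π * (centered φ σ X u π * centered φ σ X v π)
      = ∑ i, ∑ j, prob φ σ π * ((u i * (X π i - expect φ σ fun τ => X τ i))
        * (v j * (X π j - expect φ σ fun τ => X τ j))) := fun π => by
    rw [centered, centered, Finset.sum_mul_sum]
    simp only [Finset.mul_sum]
  simp only [hmul]
  rw [Finset.sum_comm (s := (Finset.univ : Finset (Equiv.Perm (Fin N))))]
  refine Finset.sum_congr rfl fun i _ => ?_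
  rw [Finset.sum_comm (s := (Finset.univ : Finset (Equiv.Perm (Fin N))))]
  refine Finset.sum_congr rfl fun j _ => ?_
  rw [covMatrix, Matrix.of_apply, expect, Finset.mul_sum, Finset.sum_mul]
  exact Finset.sum_congr rfl fun π _ => by ring

/-- Centering does not increase the second moment, and the uncentered statistic is at most `κ ‖u‖`
in absolute value for every `π`. -/
theorem sum_prob_centered_sq_le {φ : ℝ} (hφ : 0 < φ) (σ : Equiv.Perm (Fin N))
    {E : Equiv.Perm (Fin N) → EuclideanSpace ℝ (Fin d)} {κ : ℝ} (hE : ∀ π, ‖E π‖ ≤ κ)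
    (u : EuclideanSpace ℝ (Fin d)) :
    ∑ π, prob φ σ π * centered φ σ E u π ^ 2 ≤ (κ * ‖u‖) ^ 2 := by
  have h1 := sum_prob hφ σ
  have hc : ∀ π, centered φ σ E u π
      = (∑ i, u i * E π i) - ∑ τ, prob φ σ τ * ∑ i, u i * E τ i := by
    intro π
    simp only [centered, expect, mul_sub, Finset.sum_sub_distrib, Finset.mul_sum]
    rw [Finset.sum_comm]
    congr 1
    exact Finset.sum_congr rfl fun τ _ => Finset.sum_congr rfl fun i _ => by ring
  simp only [hc]
  refine (sum_weight_centered_sq_le h1 _).trans ?_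
  calc ∑ π, prob φ σ π * (∑ i, u i * E π i) ^ 2
      ≤ ∑ π, prob φ σ π * (κ * ‖u‖) ^ 2 := by
        refine Finset.sum_le_sum fun π _ => mul_le_mul_of_nonneg_left ?_ (prob_nonneg hφ σ π)
        have h2 := Finset.sum_mul_sq_le_sq_mul_sq Finset.univ (fun i => u i) (fun i => E π i)
        rw [← EuclideanSpace.real_norm_sq_eq, ← EuclideanSpace.real_norm_sq_eq] at h2
        refine h2.trans ?_
        rw [mul_pow, mul_comm]
        have := hE π
        gcongr
    _ = (κ * ‖u‖) ^ 2 := by rw [← Finset.sum_mul, h1, one_mul]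

/-- A pathwise small perturbation of a random vector with nearly isotropic diagonal covariance
keeps the covariance close to the identity. -/
theorem opNorm_covMatrix_add_sub_one_le {φ : ℝ} (hφ : 0 < φ) (σ : Equiv.Perm (Fin N))
    {X E : Equiv.Perm (Fin N) → EuclideanSpace ℝ (Fin d)} {s : Fin d → ℝ} {ε κ : ℝ}
    (hX : covMatrix φ σ X = Matrix.diagonal s) (hs1 : ∀ i, s i ≤ 1) (hsε : ∀ i, 1 - ε ≤ s i)
    (hε : 0 ≤ ε) (hκ : 0 ≤ κ) (hE : ∀ π, ‖E π‖ ≤ κ) :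
    opNorm (covMatrix φ σ (fun π => X π + E π) - 1) ≤ ε + 2 * κ + κ ^ 2 := by
  refine opNorm_le_of_abs_dotProduct_le _ (by positivity) fun u v => ?_
  have hw := prob_nonneg hφ σ
  have hdiag : ∀ u v : EuclideanSpace ℝ (Fin d),
      ∑ π, prob φ σ π * (centered φ σ X u π * centered φ σ X v π) = ∑ i, s i * (u i * v i) := by
    intro u v
    rw [← sum_covMatrix, hX]
    refine Finset.sum_congr rfl fun i _ => ?_
    rw [Finset.sum_eq_single i]
    · rw [Matrix.diagonal_apply_eq]; ring
    · intro j _ hj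
      rw [Matrix.diagonal_apply_ne _ hj.symm]; ring
    · simp
  have hXX : ∀ u : EuclideanSpace ℝ (Fin d),
      ∑ π, prob φ σ π * centered φ σ X u π ^ 2 ≤ ‖u‖ ^ 2 := by
    intro u
    simp only [sq (centered _ _ _ _ _)]
    rw [hdiag, EuclideanSpace.real_norm_sq_eq]
    refine Finset.sum_le_sum fun i _ => ?_
    nlinarith [hs1 i, mul_self_nonneg (u i)]
  have hEE := sum_prob_centered_sq_le hφ σ hE
  have hu := norm_nonneg u
  have hv := norm_nonneg v
  -- The four terms are the diagonal error, two cross terms and the pure perturbation; they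
  -- contribute `ε`, `κ`, `κ` and `κ²`.
  have hsplit : ∑ i, ∑ j, u i * (covMatrix φ σ (fun π => X π + E π) - 1) i j * v j
      = ∑ i, (s i - 1) * (u i * v i)
        + ∑ π, prob φ σ π * (centered φ σ X u π * centered φ σ E v π)
        + ∑ π, prob φ σ π * (centered φ σ E u π * centered φ σ X v π)
        + ∑ π, prob φ σ π * (centered φ σ E u π * centered φ σ E v π) := by
    have hone : ∑ i, ∑ j, u i * (1 : Matrix (Fin d) (Fin d) ℝ) i j * v j = ∑ i, u i * v i := by
      simp [Matrix.one_apply]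
    simp only [Matrix.sub_apply, mul_sub, sub_mul, Finset.sum_sub_distrib, one_mul]
    rw [hone, sum_covMatrix, ← hdiag u v]
    simp only [centered_add, add_mul, mul_add, Finset.sum_add_distrib]
    ring
  rw [hsplit]
  have t1 : |∑ i, (s i - 1) * (u i * v i)| ≤ ε * ‖u‖ * ‖v‖ := by
    have hab : ∀ i, |s i - 1| ≤ ε := fun i => abs_le.2 ⟨by linarith [hsε i], by linarith [hs1 i]⟩
    have h := abs_sum_weight_mul_le (w := fun _ : Fin d => (1 : ℝ)) (f := fun i => (s i - 1) * u i)
      (g := fun i => v i) (fun _ => zero_le_one) (s := ε * ‖u‖) (t := ‖v‖) (by positivity) hv ?_ ?_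
    · simpa [mul_assoc] using h
    · rw [mul_pow, EuclideanSpace.real_norm_sq_eq, Finset.mul_sum]
      refine Finset.sum_le_sum fun i _ => ?_
      rw [one_mul, mul_pow, ← sq_abs (s i - 1)]
      have := hab i
      gcongr
    · simp [EuclideanSpace.real_norm_sq_eq]
  have t2 := abs_sum_weight_mul_le hw hu (by positivity) (hXX u) (hEE v)
  have t3 := abs_sum_weight_mul_le hw (by positivity) hv (hEE u) (hXX v)
  have t4 := abs_sum_weight_mul_le hw (by positivity) (by positivity) (hEE u) (hEE v)
  calc _ ≤ ε * ‖u‖ * ‖v‖ + ‖u‖ * (κ * ‖v‖) + κ * ‖u‖ * ‖v‖ + κ * ‖u‖ * (κ * ‖v‖) :=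
        (abs_add_le _ _).trans (add_le_add ((abs_add_le _ _).trans
          (add_le_add ((abs_add_le _ _).trans (add_le_add t1 t2)) t3)) t4)
    _ = _ := by ring

end CovariancePerturbation


/-! ### Covariance of the front adjustment -/

section FrontAdjustment

variable {n θ : ℕ}

theorem expect_const_mul {N : ℕ} (φ : ℝ) (σ : Equiv.Perm (Fin N)) (c : ℝ)
    (f : Equiv.Perm (Fin N) → ℝ) : expect φ σ (fun π => c * f π) = c * expect φ σ f := by
  rw [expect, expect, Finset.mul_sum]
  exact Finset.sum_congr rfl fun π _ => by ring

theorem truncGeomMean_sub_self {φ : ℝ} (hφ : 0 < φ) {m : ℕ} (hm : 0 < m) (f : ℕ → ℝ) :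
    truncGeomMean φ m (fun k => f k - truncGeomMean φ m f) = 0 := by
  have hZ : 0 < ∑ k ∈ Finset.range m, φ ^ k :=
    Finset.sum_pos (fun _ _ => pow_pos hφ _) (by simpa using hm.ne')
  simp only [truncGeomMean, mul_sub, Finset.sum_sub_distrib, ← Finset.sum_mul]
  field_simp
  simp

/-- The element of `[n + 2θ]` whose entry becomes the `i`-th one after truncation. -/
def shift (i : Fin n) : Fin (n + 2 * θ) := ⟨(i : ℕ) + θ, by have := i.isLt; omega⟩

theorem shift_injective : Function.Injective (shift (n := n) (θ := θ)) := by
  intro i j h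
  have := congrArg Fin.val h
  simp only [shift] at this
  exact Fin.ext (by omega)

theorem norm_trunc_le (v : EuclideanSpace ℝ (Fin (n + 2 * θ))) : ‖trunc v‖ ≤ ‖v‖ := by
  refine le_of_sq_le_sq ?_ (norm_nonneg _)
  rw [EuclideanSpace.real_norm_sq_eq, EuclideanSpace.real_norm_sq_eq]
  calc ∑ i : Fin n, trunc v i ^ 2 = ∑ x ∈ Finset.univ.map ⟨shift, shift_injective⟩, v x ^ 2 := by
        rw [Finset.sum_map]; rfl
    _ ≤ ∑ x, v x ^ 2 :=
        Finset.sum_le_sum_of_subset_of_nonneg (Finset.subset_univ _) fun _ _ _ => sq_nonneg _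

/-- Independence kills the off-diagonal entries, and the scaling normalizes the variance `φ/(1-φ)²`
of the full geometric distribution to 1. -/
theorem covMatrix_frontAdj_self {φ : ℝ} (h0 : 0 < φ) (h1 : φ < 1)
    (σ : Equiv.Perm (Fin (n + 2 * θ))) :
    covMatrix φ σ (fun π => ((1 - φ) / √φ) • trunc (frontAdj σ π))
      = Matrix.diagonal fun i => 1 - (1 - φ) ^ 2 * ((σ.symm (shift i) + 1 : ℕ) : ℝ) ^ 2
        * φ ^ (σ.symm (shift i) : ℕ) / (1 - φ ^ ((σ.symm (shift i) : ℕ) + 1)) ^ 2 := by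
  set c := (1 - φ) / √φ with hc
  let T : Fin n → Equiv.Perm (Fin (n + 2 * θ)) → ℕ :=
    fun i π => (invSet π.symm σ.symm (shift i)).card
  have hX : ∀ i π, (c • trunc (frontAdj σ π)) i = c * (T i π : ℝ) := by
    intro i π
    rw [PiLp.smul_apply, smul_eq_mul, ← frontAdj_apply]
    rfl
  let μ : Fin n → ℝ := fun i => truncGeomMean φ ((σ.symm (shift i) : ℕ) + 1) fun k => (k : ℝ)
  have hμ : ∀ i, expect φ σ (fun π => c * (T i π : ℝ)) = c * μ i := fun i => by
    rw [expect_const_mul, expect_single h0 σ (shift i) fun k => (k : ℝ)]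
  ext i j
  simp only [covMatrix, Matrix.of_apply, hX, hμ]
  have hfac : ∀ π, (c * (T i π : ℝ) - c * μ i) * (c * (T j π : ℝ) - c * μ j)
      = c ^ 2 * (((T i π : ℝ) - μ i) * ((T j π : ℝ) - μ j)) := fun π => by ring
  simp only [hfac, expect_const_mul]
  rcases eq_or_ne i j with rfl | hij
  · rw [Matrix.diagonal_apply_eq]
    simp only [← sq (_ - μ i)]
    rw [expect_single h0 σ (shift i) fun k => ((k : ℝ) - μ i) ^ 2,
      truncGeom_variance h0 h1 (Nat.succ_pos _), hc, div_pow, Real.sq_sqrt h0.le]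
    have hp : 1 - φ ≠ 0 := (sub_pos.2 h1).ne'
    have hq : 1 - φ ^ ((σ.symm (shift i) : ℕ) + 1) ≠ 0 :=
      (sub_pos.2 (pow_lt_one₀ h0.le h1 (Nat.succ_ne_zero _))).ne'
    have hn := h0.ne'
    rw [Nat.succ_eq_add_one] at *
    set t : ℕ := (σ.symm (shift i) : ℕ)
    -- The factor `1/φ` from the squared scaling lowers `φ ^ (t + 1)` in the variance to `φ ^ t`.
    have hpow : φ ^ (t + 1) = φ ^ t * φ := pow_succ φ t
    set y := φ ^ (t + 1)
    field_simp
    rw [hpow]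
    ring
  · rw [Matrix.diagonal_apply_ne _ hij,
      expect_mul_of_ne h0 σ (fun e => hij (shift_injective e)) (fun k => (k : ℝ) - μ i)
        fun k => (k : ℝ) - μ j,
      truncGeomMean_sub_self h0 (Nat.succ_pos _) fun k => (k : ℝ)]
    ring

theorem norm_scaled_frontAdj_sub_le {φ : ℝ} (h0 : 0 < φ) (h1 : φ < 1)
    {πhat πstar : Equiv.Perm (Fin (n + 2 * θ))}
    (hD : ‖posVec πhat - posVec πstar‖ ≤ 1 / (10 * (1 - φ))) (π : Equiv.Perm (Fin (n + 2 * θ))) :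
    ‖((1 - φ) / √φ) • trunc (frontAdj πhat π - frontAdj πstar π)‖
      ≤ 2 * (‖posVec πhat - posVec πstar‖ * (1 - φ)) := by
  have hp : 0 < 1 - φ := sub_pos.2 h1
  set D := ‖posVec πhat - posVec πstar‖ with hDdef
  rcases eq_or_ne πhat πstar with rfl | hne
  · rw [sub_self]
    have h : trunc (0 : EuclideanSpace ℝ (Fin (n + 2 * θ))) = 0 := by ext i; simp [trunc]
    rw [h, smul_zero, norm_zero]
    positivity
  · have hD1 : 1 ≤ D := one_le_norm_posVec_sub hne
    -- Since `1 ≤ D ≤ 1/(10(1-φ))`, the factor `1/√φ` is harmless. Only `φ ≥ 1/2` is used below,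
    -- giving `2 · 2 = 2²`.
    have hφ : 9 / 10 ≤ φ := by
      rw [le_div_iff₀ (by positivity)] at hD
      nlinarith
    refine le_of_sq_le_sq ?_ (by positivity)
    have hE : ‖trunc (frontAdj πhat π - frontAdj πstar π)‖ ^ 2 ≤ 2 * D ^ 2 :=
      (pow_le_pow_left₀ (norm_nonneg _) (norm_trunc_le _) 2).trans
        (norm_frontAdj_sub_sq_le πhat πstar π)
    rw [norm_smul, mul_pow, Real.norm_eq_abs, sq_abs, div_pow, Real.sq_sqrt h0.le]
    calc (1 - φ) ^ 2 / φ * ‖trunc (frontAdj πhat π - frontAdj πstar π)‖ ^ 2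
        ≤ (1 - φ) ^ 2 / (1 / 2) * (2 * D ^ 2) := by
          gcongr
          linarith
      _ = _ := by ring

theorem opNorm_covMatrix_frontAdj_le {ε φ L : ℝ} (h0 : 0 < φ) (h1 : φ < 1) (hL : 1 ≤ L)
    (hLε : Real.exp (-L) ≤ ε) (hθ : 10 ^ 3 * L / (1 - φ) ≤ θ)
    {πhat πstar : Equiv.Perm (Fin (n + 2 * θ))} (hpos : ∀ i, θ ≤ (πstar.symm (shift i) : ℕ))
    (hD : ‖posVec πhat - posVec πstar‖ ≤ 1 / (10 * (1 - φ))) :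
    opNorm (covMatrix φ πstar (fun π => ((1 - φ) / √φ) • trunc (frontAdj πhat π)) - 1)
      ≤ ε + 5 * (‖posVec πhat - posVec πstar‖ * (1 - φ)) := by
  have hp : 0 < 1 - φ := sub_pos.2 h1
  have hsplit : (fun π => ((1 - φ) / √φ) • trunc (frontAdj πhat π))
      = fun π => ((1 - φ) / √φ) • trunc (frontAdj πstar π)
        + ((1 - φ) / √φ) • trunc (frontAdj πhat π - frontAdj πstar π) := by
    funext π
    rw [← smul_add]
    congr 1
    ext i
    simp [trunc]
  set D := ‖posVec πhat - posVec πstar‖ with hDdef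
  have hδ0 : 0 ≤ D * (1 - φ) := by positivity
  have hδ1 : D * (1 - φ) ≤ 1 / 10 := by
    rw [le_div_iff₀ (by positivity)] at hD
    linarith
  rw [hsplit]
  refine (opNorm_covMatrix_add_sub_one_le h0 πstar (covMatrix_frontAdj_self h0 h1 πstar)
    (ε := ε) (κ := 2 * (D * (1 - φ))) ?_ ?_ ((Real.exp_pos _).le.trans hLε) (by positivity)
    fun π => norm_scaled_frontAdj_sub_le h0 h1 hD π).trans ?_
  · intro i
    have : (0 : ℝ) ≤ (1 - φ) ^ 2 * ((πstar.symm (shift i) + 1 : ℕ) : ℝ) ^ 2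
        * φ ^ (πstar.symm (shift i) : ℕ) / (1 - φ ^ ((πstar.symm (shift i) : ℕ) + 1)) ^ 2 := by
      positivity
    linarith
  · intro i
    -- The bound is applied at the actual position, which is at least `θ`, so no monotonicity in the
    -- position is needed.
    have := truncGeom_deviation_le h0 h1 hL (t := (πstar.symm (shift i) : ℕ))
      (hθ.trans (by exact_mod_cast hpos i))
    linarith
  -- With `δ = D(1-φ) ≤ 1/10` and `κ = 2δ`, the loss `2κ + κ²` is `4δ + 4δ² ≤ 5δ`.
  · nlinarith

end FrontAdjustment

/-! ### Reversal symmetry between front and back -/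

section Reversal

variable {N : ℕ}

/-- Right multiplication by `Fin.revPerm` reverses positions and keeps elements, so it exchanges
"before" and "after". -/
theorem frontAdj_revPerm_mul (πhat π : Equiv.Perm (Fin N)) :
    frontAdj (πhat * Fin.revPerm) (π * Fin.revPerm) = backAdj πhat π := by
  ext i
  simp [frontAdj, backAdj, Equiv.Perm.mul_def]

theorem kendallTau_mul_revPerm (π σ : Equiv.Perm (Fin N)) :
    kendallTau (π * Fin.revPerm) (σ * Fin.revPerm) = kendallTau π σ := by
  simp only [kendallTau]
  congr 1
  ext x
  simp only [Finset.mem_filter, Finset.mem_univ, true_and, Equiv.Perm.mul_def,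
    Equiv.symm_trans_apply, Fin.revPerm_symm, Fin.revPerm_apply, Fin.rev_lt_rev]
  refine and_congr_right fun h => not_congr ?_
  have h1 : π.symm x.1 ≠ π.symm x.2 := fun e => h.ne (π.symm.injective e)
  have h2 : σ.symm x.1 ≠ σ.symm x.2 := fun e => h.ne (σ.symm.injective e)
  grind

theorem expect_mul_revPerm (φ : ℝ) (σ : Equiv.Perm (Fin N)) (f : Equiv.Perm (Fin N) → ℝ) :
    expect φ (σ * Fin.revPerm) f = expect φ σ fun π => f (π * Fin.revPerm) := by
  have hZ : partitionFn φ (σ * Fin.revPerm) = partitionFn φ σ := by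
    rw [partitionFn, partitionFn, ← Equiv.sum_comp (Equiv.mulRight (Fin.revPerm (n := N)))]
    simp [kendallTau_mul_revPerm]
  rw [expect, expect, ← Equiv.sum_comp (Equiv.mulRight (Fin.revPerm (n := N)))]
  simp [prob, kendallTau_mul_revPerm, hZ]

theorem covMatrix_mul_revPerm {d : ℕ} (φ : ℝ) (σ : Equiv.Perm (Fin N))
    (X : Equiv.Perm (Fin N) → EuclideanSpace ℝ (Fin d)) :
    covMatrix φ (σ * Fin.revPerm) X = covMatrix φ σ fun π => X (π * Fin.revPerm) := by
  simp only [covMatrix, expect_mul_revPerm]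

theorem norm_posVec_mul_revPerm_sub (π σ : Equiv.Perm (Fin N)) :
    ‖posVec (π * Fin.revPerm) - posVec (σ * Fin.revPerm)‖ = ‖posVec π - posVec σ‖ := by
  have hneg : posVec (π * Fin.revPerm) - posVec (σ * Fin.revPerm) = -(posVec π - posVec σ) := by
    have hval : ∀ k : Fin N, ((N - (k + 1) : ℕ) : ℝ) = N - (k + 1) := fun k => by
      rw [Nat.cast_sub k.isLt]
      push_cast
      rfl
    ext i
    simp only [posVec, PiLp.sub_apply, PiLp.neg_apply, Equiv.Perm.mul_def, Equiv.symm_trans_apply,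
      Fin.revPerm_symm, Fin.revPerm_apply, Fin.val_rev, hval]
    ring
  rw [hneg, norm_neg]

end Reversal

/-- An end position holds its own label, so it cannot hold a middle element. The lower bound serves
the front adjustment; the upper bound serves the back adjustment, after reversal. -/
theorem MatchesIdAtEnds.symm_shift_mem {n θ : ℕ} {π : Equiv.Perm (Fin (n + 2 * θ))}
    (h : MatchesIdAtEnds π) (i : Fin n) :
    θ ≤ (π.symm (shift i) : ℕ) ∧ (π.symm (shift i) : ℕ) < n + θ := by
  by_contra hc
  have hfix := h (π.symm (shift i)) (by omega)
  rw [Equiv.apply_symm_apply] at hfix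
  rw [← hfix] at hc
  have := i.isLt
  simp only [shift] at hc
  omega

end Mallows

theorem lemma6p4 :
    ∃ C : ℝ, 0 < C ∧
      ∀ (n : ℕ) (ε φ : ℝ), 1 ≤ n → 0 < ε → ε < 1 / 10 → 0 < φ → φ < 1 →
      ∀ πhat πstar : Equiv.Perm (Fin (n + 2 * Mallows.padLen n ε φ)),
        Mallows.MatchesIdAtEnds πhat → Mallows.MatchesIdAtEnds πstar →
        ‖Mallows.posVec πhat - Mallows.posVec πstar‖ ≤ 1 / (10 * (1 - φ)) →
        Mallows.opNorm
            (Mallows.covMatrix φ πstar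
              (fun π => ((1 - φ) / Real.sqrt φ) • Mallows.trunc (Mallows.frontAdj πhat π)) - 1)
          ≤ ε + C * (‖Mallows.posVec πhat - Mallows.posVec πstar‖ * (1 - φ)) ∧
        Mallows.opNorm
            (Mallows.covMatrix φ πstar
              (fun π => ((1 - φ) / Real.sqrt φ) • Mallows.trunc (Mallows.backAdj πhat π)) - 1)
          ≤ ε + C * (‖Mallows.posVec πhat - Mallows.posVec πstar‖ * (1 - φ)) := by
  refine ⟨5, by norm_num, ?_⟩
  intro n ε φ hn hε hε' h0 h1 πhat πstar _ hstar hD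
  have hn1 : (1 : ℝ) ≤ n := by exact_mod_cast hn
  have hpos : (0 : ℝ) < n / ε := by positivity
  have hL : 1 ≤ Real.log (n / ε) := by
    -- Here `n/ε > 10 > e`.
    rw [Real.le_log_iff_exp_le hpos]
    refine Real.exp_one_lt_d9.le.trans ?_
    rw [le_div_iff₀ hε]
    linarith
  have hLε : Real.exp (-Real.log (n / ε)) ≤ ε := by
    rw [Real.exp_neg, Real.exp_log hpos, inv_div]
    exact div_le_self hε.le hn1
  have hθ : 10 ^ 3 * Real.log (n / ε) / (1 - φ) ≤ Mallows.padLen n ε φ := Nat.le_ceil _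
  constructor
  · exact Mallows.opNorm_covMatrix_frontAdj_le h0 h1 hL hLε hθ
      (fun i => (hstar.symm_shift_mem i).1) hD
  · have h := Mallows.opNorm_covMatrix_frontAdj_le (πhat := πhat * Fin.revPerm)
      (πstar := πstar * Fin.revPerm) h0 h1 hL hLε hθ ?_
      (by rwa [Mallows.norm_posVec_mul_revPerm_sub])
    · rw [Mallows.norm_posVec_mul_revPerm_sub, Mallows.covMatrix_mul_revPerm] at h
      simpa only [Mallows.frontAdj_revPerm_mul] using h
    -- Reversal sends a position `p < n + θ` to `n + 2θ - (p + 1) ≥ θ`.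
    · intro i
      have := (hstar.symm_shift_mem i).2
      simp only [Equiv.Perm.mul_def, Equiv.symm_trans_apply, Fin.revPerm_symm, Fin.revPerm_apply,
        Fin.val_rev]
      omega
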